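/- **Theorem (non-commutative Fejér–Riesz theorem).** Let $d, n \ge 0$ be integers, let $\mathcal F_d^+$ be the free monoid of words in the letters $1,\dots,d$ (with $|v|$ the length of a word $v$ and $\varnothing$ the empty word), and let $\ell^2(\mathcal F_d^+)$ be the complex Hilbert space with orthonormal basis $\{\xi_w\}_{w\in\mathcal F_d^+}$. Let $L_1,\dots,L_d$ be the left creation operators on $\ell^2(\mathcal F_d^+)$, the bounded operators with $L_j\xi_w=\xi_{jw}$, and put $L_v=L_{i_1}L_{i_2}\cdots L_{i_k}$ for a word $v=i_1i_2\cdots i_k$, with $L_\varnothing=I$. Let $\mathcal H$ be a complex Hilbert space, and let $Q_v:\mathcal H\to\mathcal H$, $|v|\le n$, be bounded operators such that the operator $$T_Q = Q_\varnothing\otimes I+\sum_{0<|v|\le n}Q_v\otimes L_v+\sum_{0<|v|\le n}Q_v^*\otimes L_v^*$$ on the Hilbert space tensor product $\mathcal H\otimes\ell^2(\mathcal F_d^+)$ is positive (that is, self-adjoint with $\langle T_Qx,x\rangle\ge 0$ for all $x$). Then there exist bounded operators $F_v:\mathcal H\to\mathcal H$, $|v|\le n$, such that $$T_Q=T_F^*\,T_F,\qquad\text{where}\quad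 T_F=\sum_{|v|\le n}F_v\otimes L_v .$$ -/

import Mathlib

open scoped TensorProduct

noncomputable section

namespace FejerRiesz

/-- The free monoid of words in the letters `1, …, d`. The empty word is `1`. -/
abbrev Word (d : ℕ) : Type := FreeMonoid (Fin d)

instance instDecidableEqWord (d : ℕ) : DecidableEq (Word d) :=
  inferInstanceAs (DecidableEq (List (Fin d)))

/-- The Fock space `ℓ²(F_d⁺)`. -/
abbrev Fock (d : ℕ) : Type := lp (fun _ : Word d => ℂ) 2

/-- The standard orthonormal basis `ξ_w` of the Fock space. -/
def xi {d : ℕ} (w : Word d) : Fock d := lp.single 2 w (1 : ℂ)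

theorem xi_eq_repr_symm {d : ℕ} (w : Word d) :
    xi w = (HilbertBasis.ofRepr (LinearIsometryEquiv.refl ℂ (Fock d)) :
      HilbertBasis (Word d) ℂ (Fock d)) w := by
  rw [← HilbertBasis.repr_symm_single]
  rfl

theorem orthonormal_xi (d : ℕ) : Orthonormal ℂ (xi : Word d → Fock d) := by
  have h : (xi : Word d → Fock d) =
      (HilbertBasis.ofRepr (LinearIsometryEquiv.refl ℂ (Fock d)) :
        HilbertBasis (Word d) ℂ (Fock d)) := funext xi_eq_repr_symm
  rw [h]
  exact HilbertBasis.orthonormal _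

theorem orthonormal_xi_of_mul {d : ℕ} (j : Fin d) :
    Orthonormal ℂ (fun w : Word d => (xi (FreeMonoid.of j * w) : Fock d)) :=
  (orthonormal_xi d).comp _ fun _ _ h => List.cons_injective h

/-- The left creation operator `L_j`, the bounded operator with `L_j ξ_w = ξ_{jw}`
(see `leftCreation_xi`). -/
def leftCreation {d : ℕ} (j : Fin d) : Fock d →L[ℂ] Fock d :=
  (orthonormal_xi_of_mul j).orthogonalFamily.linearIsometry.toContinuousLinearMap

theorem leftCreation_xi {d : ℕ} (j : Fin d) (w : Word d) :
    leftCreation j (xi w) = xi (FreeMonoid.of j * w) := by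
  have h := (orthonormal_xi_of_mul j).orthogonalFamily.linearIsometry_apply_single
    (i := w) (1 : ℂ)
  simp only [LinearIsometry.toSpanSingleton_apply, one_smul] at h
  exact h

/-- `L_w = L_{i₁} L_{i₂} ⋯ L_{iₖ}` for the word `w = i₁ i₂ ⋯ iₖ`; `L_1 = I` for the empty word. -/
def leftCreationWord {d : ℕ} (w : Word d) : Fock d →L[ℂ] Fock d :=
  FreeMonoid.lift leftCreation w

theorem leftCreationWord_xi {d : ℕ} (v w : Word d) :
    leftCreationWord v (xi w) = xi (v * w) := by
  induction v using FreeMonoid.inductionOn' with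
  | one => simp [leftCreationWord]
  | of_mul j v ih =>
    have : leftCreationWord (FreeMonoid.of j * v) = leftCreation j * leftCreationWord v := by
      simp [leftCreationWord]
    rw [this, mul_apply_eq_comp, ih, leftCreation_xi, mul_assoc]

variable {E F : Type*} [NormedAddCommGroup E] [InnerProductSpace ℂ E]
  [NormedAddCommGroup F] [InnerProductSpace ℂ F]

/-- The Hilbert space tensor product: the completion of the algebraic tensor product for the
inner product with `⟪a ⊗ b, c ⊗ e⟫ = ⟪a, c⟫ ⟪b, e⟫`. -/
abbrev HilbertTensor (E F : Type*) [NormedAddCommGroup E] [InnerProductSpace ℂ E]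
    [NormedAddCommGroup F] [InnerProductSpace ℂ F] : Type _ :=
  UniformSpace.Completion (E ⊗[ℂ] F)

/-- The tensor product `A ⊗ B` of bounded operators on the Hilbert space tensor product: the
continuous extension of the algebraic tensor product of `A` and `B`
(see `opTensor_tmul`). -/
def opTensor (A : E →L[ℂ] E) (B : F →L[ℂ] F) : HilbertTensor E F →L[ℂ] HilbertTensor E F :=
  ((UniformSpace.Completion.toComplL : (E ⊗[ℂ] F) →L[ℂ] HilbertTensor E F) ∘L
    TensorProduct.mapL A B).extend
      (UniformSpace.Completion.toComplL : (E ⊗[ℂ] F) →L[ℂ] HilbertTensor E F)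

theorem opTensor_coe (A : E →L[ℂ] E) (B : F →L[ℂ] F) (x : E ⊗[ℂ] F) :
    opTensor A B (x : HilbertTensor E F) =
      ((TensorProduct.mapL A B x : E ⊗[ℂ] F) : HilbertTensor E F) :=
  ContinuousLinearMap.extend_eq _ (UniformSpace.Completion.denseRange_coe)
    (UniformSpace.Completion.isUniformInducing_coe _) x

theorem opTensor_tmul (A : E →L[ℂ] E) (B : F →L[ℂ] F) (x : E) (y : F) :
    opTensor A B ((x ⊗ₜ[ℂ] y : E ⊗[ℂ] F) : HilbertTensor E F) =
      ((A x ⊗ₜ[ℂ] B y : E ⊗[ℂ] F) : HilbertTensor E F) := by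
  rw [opTensor_coe, TensorProduct.mapL_tmul]

theorem finite_setOf_length_le (d n : ℕ) : {v : Word d | v.length ≤ n}.Finite :=
  List.finite_length_le (Fin d) n

/-- The words `v` with `|v| ≤ n`. -/
def wordsLE (d n : ℕ) : Finset (Word d) := (finite_setOf_length_le d n).toFinset

@[simp] theorem mem_wordsLE {d n : ℕ} {v : Word d} : v ∈ wordsLE d n ↔ v.length ≤ n := by
  simp [wordsLE]

variable {H : Type*} [NormedAddCommGroup H] [InnerProductSpace ℂ H]

/-- The analytic polynomial `T_F = ∑_{|v| ≤ n} F_v ⊗ L_v`. Only the coefficients `F_v` with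
`|v| ≤ n` matter. -/
def analyticPoly {d : ℕ} (n : ℕ) (F : Word d → H →L[ℂ] H) :
    HilbertTensor H (Fock d) →L[ℂ] HilbertTensor H (Fock d) :=
  ∑ v ∈ wordsLE d n, opTensor (F v) (leftCreationWord v)

/-- The multi-Toeplitz polynomial
`T_Q = Q_∅ ⊗ I + ∑_{0 < |v| ≤ n} Q_v ⊗ L_v + ∑_{0 < |v| ≤ n} Q_v^* ⊗ L_v^*`. Only the
coefficients `Q_v` with `|v| ≤ n` matter. -/
def toeplitzPoly [CompleteSpace H] {d : ℕ} (n : ℕ) (Q : Word d → H →L[ℂ] H) :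
    HilbertTensor H (Fock d) →L[ℂ] HilbertTensor H (Fock d) :=
  opTensor (Q 1) (ContinuousLinearMap.id ℂ (Fock d)) +
    ∑ v ∈ wordsLE d n with 0 < v.length, opTensor (Q v) (leftCreationWord v) +
    ∑ v ∈ wordsLE d n with 0 < v.length,
      opTensor (ContinuousLinearMap.adjoint (Q v))
        (ContinuousLinearMap.adjoint (leftCreationWord v))

end FejerRiesz

end

/-! Write `T_Q = S† S` with `S` the positive square root, let `G` be the closure of the range of
`S`, and let `e` be `S` viewed as a map into `G`. Multi-Toeplitz structure means `R_i† T_Q R_j =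
δ_ij T_Q` for the right creation operators (`inner_toeplitzPoly_rightCreation`), so `e x ↦ e (R_j
x)` extends to isometries `V_j` of `G` with orthogonal ranges.

Since `T_Q` has degree at most `n`, each `e (h ⊗ ξ_∅)` is orthogonal to `V_w G` for `|w| = n + 1`.
Its Wold decomposition `∑ V_v A_v h` therefore stops at `|v| = n`, with `A_v h` in the wandering
space `W` (`sum_revWordOp_wandering`). The projection onto `W` kills every `e (h ⊗ ξ_w)` with `w ≠
∅`, so `W` is the closed range of an operator on `H` and embeds in `H` by an isometry `J`. Put `F_v
= J A_v`: the subspaces `V_w W` are pairwise orthogonal, just as the `H ⊗ ξ_w` are, so `T_F` and `e`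
have the same Gram matrix. -/

noncomputable section

namespace FejerRiesz

/-! ### Square roots and isometric extension in Hilbert space -/

section Hilbert

variable {E F : Type*} [NormedAddCommGroup E] [InnerProductSpace ℂ E]
  [NormedAddCommGroup F] [InnerProductSpace ℂ F]

local notation "⟪" x ", " y "⟫" => inner ℂ x y

/-- The closure of the range of a bounded operator. -/
abbrev closedRange (A : E →L[ℂ] F) : Submodule ℂ F :=
  (LinearMap.range A.toLinearMap).topologicalClosure

/-- A bounded operator, regarded as an operator into the closure of its range. -/
def toClosedRange (A : E →L[ℂ] F) : E →L[ℂ] closedRange A :=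
  A.codRestrict _ fun x => Submodule.le_topologicalClosure _ ⟨x, rfl⟩

@[simp] theorem coe_toClosedRange (A : E →L[ℂ] F) (x : E) : (toClosedRange A x : F) = A x := rfl

theorem denseRange_toClosedRange (A : E →L[ℂ] F) : DenseRange (toClosedRange A) := by
  intro y
  rw [closure_subtype, ← Set.range_comp]
  exact y.2

variable [CompleteSpace F]

/-- If `‖f x‖ = ‖e x‖` for all `x` and `e` has dense range, then `f` extends along `e`. -/
theorem exists_extension_of_inner_eq {X : Type*} [NormedAddCommGroup X] [InnerProductSpace ℂ X]
    (e : X →L[ℂ] E) (f : X →L[ℂ] F)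
    (he : DenseRange e) (h : ∀ x, ⟪f x, f x⟫ = ⟪e x, e x⟫) :
    ∃ U : E →L[ℂ] F, ∀ x, U (e x) = f x := by
  have hn : ∀ x, ‖f x‖ ≤ 1 * ‖e x‖ := fun x => by
    rw [one_mul, @norm_eq_sqrt_re_inner ℂ, @norm_eq_sqrt_re_inner ℂ, h]
  exact ⟨f.toLinearMap.extendOfNorm e.toLinearMap,
    fun x => LinearMap.extendOfNorm_eq he ⟨1, hn⟩ x⟩

variable [CompleteSpace E]

/-- Every positive operator `T` is of the form `S† S`. -/
theorem exists_inner_eq_of_isPositive {T : E →L[ℂ] E} (hT : T.IsPositive) :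
    ∃ S : E →L[ℂ] E, ∀ x y, ⟪S x, S y⟫ = ⟪x, T y⟫ := by
  have h0 : 0 ≤ T := (ContinuousLinearMap.nonneg_iff_isPositive T).2 hT
  refine ⟨CFC.sqrt T, fun x y => ?_⟩
  have hS : (CFC.sqrt T).IsPositive :=
    (ContinuousLinearMap.nonneg_iff_isPositive _).1 (CFC.sqrt_nonneg T)
  conv_rhs => rw [← CFC.sqrt_mul_sqrt_self T h0]
  exact hS.isSymmetric x (CFC.sqrt T y)

/-- The closure of the range of an operator `C : E → F` embeds isometrically into `E`. -/
theorem exists_isometric_on_closedRange (C : E →L[ℂ] F) :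
    ∃ J : F →L[ℂ] E, ∀ x ∈ closedRange C, ∀ y ∈ closedRange C, ⟪J x, J y⟫ = ⟪x, y⟫ := by
  -- Polar decomposition: `D = |C|` acts on `E` and satisfies `‖D x‖ = ‖C x‖`, so `C x ↦ D x` is
  -- isometric.
  obtain ⟨D, hD⟩ := exists_inner_eq_of_isPositive (ContinuousLinearMap.isPositive_adjoint_comp_self C)
  have hD' : ∀ x y, ⟪D x, D y⟫ = ⟪C x, C y⟫ := fun x y => by
    rw [hD, ContinuousLinearMap.comp_apply, ContinuousLinearMap.adjoint_inner_right]
  obtain ⟨U, hU⟩ := exists_extension_of_inner_eq (toClosedRange C) D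
    (denseRange_toClosedRange C) (fun x => hD' x x)
  have hiso : ∀ x y, ⟪U x, U y⟫ = ⟪x, y⟫ := by
    intro x y
    refine (denseRange_toClosedRange C).induction_on₂ (p := fun x y => ⟪U x, U y⟫ = ⟪x, y⟫)
      ?_ ?_ x y
    · exact isClosed_eq (by fun_prop) (by fun_prop)
    · intro a b
      rw [hU, hU, hD', Submodule.coe_inner, coe_toClosedRange, coe_toClosedRange]
  refine ⟨U ∘L (closedRange C).orthogonalProjectionOnto, fun x hx y hy => ?_⟩
  simp only [ContinuousLinearMap.comp_apply, hiso]
  rw [Submodule.coe_inner, Submodule.coe_orthogonalProjectionOnto_apply,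
    Submodule.coe_orthogonalProjectionOnto_apply, Submodule.starProjection_eq_self_iff.2 hx,
    Submodule.starProjection_eq_self_iff.2 hy]

end Hilbert

/-! ### Row isometries and the Wold decomposition -/

section RowIsometry

open ContinuousLinearMap

variable {G : Type*} [NormedAddCommGroup G] [InnerProductSpace ℂ G] {d : ℕ}

local notation "⟪" x ", " y "⟫" => inner ℂ x y

/-- `V_w = V_{iₖ} ⋯ V_{i₁}` for the word `w = i₁ ⋯ iₖ`. -/
def revWordOp (V : Fin d → G →L[ℂ] G) (w : Word d) : G →L[ℂ] G :=
  (FreeMonoid.lift (fun j => MulOpposite.op (V j)) w).unop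

theorem revWordOp_one (V : Fin d → G →L[ℂ] G) : revWordOp V 1 = 1 := by simp [revWordOp]

theorem revWordOp_mul (V : Fin d → G →L[ℂ] G) (v w : Word d) :
    revWordOp V (v * w) = revWordOp V w * revWordOp V v := by simp [revWordOp]

theorem revWordOp_mul_of (V : Fin d → G →L[ℂ] G) (w : Word d) (j : Fin d) :
    revWordOp V (w * FreeMonoid.of j) = V j * revWordOp V w := by simp [revWordOp]

variable [CompleteSpace G]

/-- `1 - ∑ V_j V_j^*`, for isometries `V_j` with orthogonal ranges the projection onto the
wandering subspace. -/
def wandering (V : Fin d → G →L[ℂ] G) : G →L[ℂ] G := 1 - ∑ j, V j * adjoint (V j)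

theorem wandering_apply (V : Fin d → G →L[ℂ] G) (x : G) :
    wandering V x = x - ∑ j, V j (adjoint (V j) x) := by
  simp [wandering]

theorem inner_wandering_left (V : Fin d → G →L[ℂ] G) (x y : G) :
    ⟪wandering V x, y⟫ = ⟪x, wandering V y⟫ := by
  have h : ∀ j, ⟪V j (adjoint (V j) x), y⟫ = ⟪x, V j (adjoint (V j) y)⟫ := fun j => by
    rw [← adjoint_inner_right (V j), adjoint_inner_left (V j)]
  simp only [wandering_apply, inner_sub_left, inner_sub_right, sum_inner, inner_sum, h]

theorem word_reverse_induction {p : Word d → Prop} (one : p 1)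
    (mul_of : ∀ w j, p w → p (w * FreeMonoid.of j)) (w : Word d) : p w :=
  List.reverseRecOn (motive := p) w one fun w j h => mul_of w j h

theorem mul_of_inj {v w : Word d} {i j : Fin d} :
    v * FreeMonoid.of i = w * FreeMonoid.of j ↔ i = j ∧ v = w := by
  refine ⟨fun h => ?_, by rintro ⟨rfl, rfl⟩; rfl⟩
  have := List.append_inj'
    (h : FreeMonoid.toList v ++ [i] = FreeMonoid.toList w ++ [j]) rfl
  exact ⟨List.singleton_injective this.2, this.1⟩

theorem mul_of_ne_one (w : Word d) (j : Fin d) : w * FreeMonoid.of j ≠ 1 :=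
  fun h => List.append_ne_nil_of_right_ne_nil (FreeMonoid.toList w) (List.cons_ne_nil j []) h

/-- The `V_j` are isometries with pairwise orthogonal ranges. -/
def IsRowIsometry (V : Fin d → G →L[ℂ] G) : Prop :=
  ∀ i j x y, ⟪V i x, V j y⟫ = if i = j then ⟪x, y⟫ else 0

variable {V : Fin d → G →L[ℂ] G}

/-- Since `V_i† V_j = δ_ij`, only the term `V_j x` survives in `∑ V_i V_i† V_j x`. -/
theorem IsRowIsometry.wandering_apply_isometry (hV : IsRowIsometry V) (j : Fin d) (x : G) :
    wandering V (V j x) = 0 := by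
  refine ext_inner_left ℂ fun y => ?_
  have : ∀ i, ⟪y, V i (adjoint (V i) (V j x))⟫ = if i = j then ⟪y, V j x⟫ else 0 := by
    intro i
    rw [← adjoint_inner_left, adjoint_inner_right, hV]
    split_ifs with h
    · rw [h, adjoint_inner_left]
    · rfl
  simp [wandering_apply, inner_sub_right, inner_sum, this]

theorem IsRowIsometry.inner_isometry_wandering (hV : IsRowIsometry V) (j : Fin d) (x y : G) :
    ⟪V j x, wandering V y⟫ = 0 := by
  rw [← inner_wandering_left, hV.wandering_apply_isometry, inner_zero_left]

/-- The subspaces `V_w W`, with `W` the wandering subspace, are pairwise orthogonal. -/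
theorem IsRowIsometry.inner_revWordOp_wandering (hV : IsRowIsometry V) (v w : Word d) (x y : G) :
    ⟪revWordOp V v (wandering V x), revWordOp V w (wandering V y)⟫ =
      if v = w then ⟪wandering V x, wandering V y⟫ else 0 := by
  -- The last letter of a word gives the outermost factor of `revWordOp`, so it is the one to strip.
  induction v using word_reverse_induction generalizing w with
  | one =>
    induction w using word_reverse_induction with
    | one => simp [revWordOp_one]
    | mul_of w j _ =>
      rw [if_neg (mul_of_ne_one w j).symm, revWordOp_one, revWordOp_mul_of,
        one_apply_eq_self, mul_apply_eq_comp, ← inner_conj_symm,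
        hV.inner_isometry_wandering, map_zero]
  | mul_of v i ih =>
    induction w using word_reverse_induction with
    | one =>
      rw [if_neg (mul_of_ne_one v i), revWordOp_one, revWordOp_mul_of,
        one_apply_eq_self, mul_apply_eq_comp, hV.inner_isometry_wandering]
    | mul_of w j _ =>
      simp only [revWordOp_mul_of, mul_apply_eq_comp, hV i j, ih w, mul_of_inj, ite_and]

theorem adjoint_one : adjoint (1 : G →L[ℂ] G) = 1 := by
  rw [← star_eq_adjoint, star_one]

theorem wordsLE_zero : wordsLE d 0 = {1} := by
  ext v
  simp [FreeMonoid.length_eq_zero]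

theorem sum_wordsLE_succ {M : Type*} [AddCommMonoid M] (n : ℕ) (f : Word d → M) :
    ∑ v ∈ wordsLE d (n + 1), f v =
      f 1 + ∑ j, ∑ v ∈ wordsLE d n, f (v * FreeMonoid.of j) := by
  have h : wordsLE d (n + 1) = insert 1 ((Finset.univ ×ˢ wordsLE d n).image
      fun p : Fin d × Word d => p.2 * FreeMonoid.of p.1) := by
    ext v
    induction v using word_reverse_induction with
    | one => simp
    | mul_of v j => simp [mul_of_inj]
  rw [h, Finset.sum_insert, Finset.sum_image, Finset.sum_product]
  · rintro ⟨i, v⟩ - ⟨j, w⟩ - h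
    simpa [mul_of_inj] using h
  · simp

/-- Wold decomposition of a vector that is orthogonal to all `V_w G` with `|w| = n + 1`. -/
theorem sum_revWordOp_wandering (V : Fin d → G →L[ℂ] G) (n : ℕ) (x : G)
    (hx : ∀ w : Word d, w.length = n + 1 → adjoint (revWordOp V w) x = 0) :
    ∑ v ∈ wordsLE d n, revWordOp V v (wandering V (adjoint (revWordOp V v) x)) = x := by
  induction n generalizing x with
  | zero =>
    have h : ∀ j, adjoint (V j) x = 0 := fun j => by
      simpa [revWordOp] using hx (FreeMonoid.of j) rfl
    simp [wordsLE_zero, adjoint_one, revWordOp_one, wandering_apply, h]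
  | succ n ih =>
    have hadj : ∀ (j : Fin d) (v : Word d), adjoint (revWordOp V (v * FreeMonoid.of j)) x =
        adjoint (revWordOp V v) (adjoint (V j) x) := fun j v => by
      rw [revWordOp_mul_of, ← star_eq_adjoint, star_mul]
      rfl
    have h : ∀ j, ∑ v ∈ wordsLE d n, revWordOp V (v * FreeMonoid.of j)
        (wandering V (adjoint (revWordOp V (v * FreeMonoid.of j)) x)) =
          V j (adjoint (V j) x) := fun j => by
      -- `V_j† x` is annihilated one level earlier, because `V_w† V_j† = V_{wj}†`.
      conv_rhs => rw [← ih (adjoint (V j) x) fun w hw => by rw [← hadj, hx]; simp [hw]]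
      simp only [hadj, map_sum]
      simp only [revWordOp_mul_of, mul_apply_eq_comp]
    rw [sum_wordsLE_succ, Finset.sum_congr rfl fun j _ => h j]
    simp [adjoint_one, revWordOp_one, wandering_apply]

end RowIsometry

/-! ### Matrix coefficients, the Toeplitz property and the factorization -/

section Factorization

open ContinuousLinearMap

local notation "⟪" x ", " y "⟫" => inner ℂ x y

variable {H : Type*} [NormedAddCommGroup H] [InnerProductSpace ℂ H] {d : ℕ}

theorem inner_xi (v w : Word d) : ⟪(xi v : Fock d), xi w⟫ = if v = w then 1 else 0 :=
  orthonormal_iff_ite.1 (orthonormal_xi d) v w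

theorem dense_span_xi (d : ℕ) :
    Dense (Submodule.span ℂ (Set.range (xi : Word d → Fock d)) : Set (Fock d)) := by
  have h : (xi : Word d → Fock d) =
      (HilbertBasis.ofRepr (LinearIsometryEquiv.refl ℂ (Fock d)) :
        HilbertBasis (Word d) ℂ (Fock d)) := funext xi_eq_repr_symm
  rw [h]
  exact Submodule.dense_iff_topologicalClosure_eq_top.2 (HilbertBasis.dense_span _)

/-- The embedding `h ↦ h ⊗ ξ_w` of the summand with index `w`. -/
def tmulXi (w : Word d) : H →L[ℂ] HilbertTensor H (Fock d) :=
  (UniformSpace.Completion.toComplL : (H ⊗[ℂ] Fock d) →L[ℂ] HilbertTensor H (Fock d)) ∘L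
    (TensorProduct.mkL ℂ H (Fock d)).flip (xi w)

theorem tmulXi_apply (w : Word d) (h : H) :
    tmulXi w h = ((h ⊗ₜ[ℂ] (xi w : Fock d) : H ⊗[ℂ] Fock d) : HilbertTensor H (Fock d)) := rfl

theorem inner_tmulXi (v w : Word d) (g h : H) :
    ⟪tmulXi v g, tmulXi w h⟫ = if v = w then ⟪g, h⟫ else 0 := by
  rw [tmulXi_apply, tmulXi_apply, UniformSpace.Completion.inner_coe, TensorProduct.inner_tmul,
    inner_xi]
  simp

theorem opTensor_tmulXi (A : H →L[ℂ] H) (B : Fock d →L[ℂ] Fock d) (w : Word d) (h : H) :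
    opTensor A B (tmulXi w h) =
      ((A h ⊗ₜ[ℂ] B (xi w) : H ⊗[ℂ] Fock d) : HilbertTensor H (Fock d)) := by
  rw [tmulXi_apply, opTensor_tmul]

theorem opTensor_leftCreationWord_tmulXi (A : H →L[ℂ] H) (v w : Word d) (h : H) :
    opTensor A (leftCreationWord v) (tmulXi w h) = tmulXi (v * w) (A h) := by
  rw [opTensor_tmulXi, leftCreationWord_xi, tmulXi_apply]

theorem ext_tmulXi {X : Type*} [NormedAddCommGroup X] [NormedSpace ℂ X]
    {A B : HilbertTensor H (Fock d) →L[ℂ] X}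
    (hAB : ∀ w h, A (tmulXi w h) = B (tmulXi w h)) : A = B := by
  refine ContinuousLinearMap.ext
    (UniformSpace.Completion.ext' A.continuous B.continuous fun t => ?_)
  induction t using TensorProduct.induction_on with
  | zero => rw [UniformSpace.Completion.coe_zero, map_zero, map_zero]
  | add s t hs ht => simp [UniformSpace.Completion.coe_add, hs, ht]
  | tmul h f =>
    let ι : Fock d →L[ℂ] HilbertTensor H (Fock d) :=
      (UniformSpace.Completion.toComplL : (H ⊗[ℂ] Fock d) →L[ℂ] HilbertTensor H (Fock d)) ∘L
        TensorProduct.mkL ℂ H (Fock d) h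
    have : A ∘L ι = B ∘L ι := ContinuousLinearMap.ext_on (dense_span_xi d) (by
      rintro _ ⟨w, rfl⟩
      exact hAB w h)
    exact DFunLike.congr_fun this f

/-- Operators are determined by their matrix coefficients. -/
theorem ext_inner_tmulXi {A B : HilbertTensor H (Fock d) →L[ℂ] HilbertTensor H (Fock d)}
    (hAB : ∀ v w g h, ⟪tmulXi v g, A (tmulXi w h)⟫ = ⟪tmulXi v g, B (tmulXi w h)⟫) : A = B := by
  refine ext_tmulXi fun w h => ?_
  refine ext_inner_right ℂ fun y => ?_
  rw [← inner_conj_symm, ← inner_conj_symm (B _)]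
  congr 1
  have : innerSL ℂ (A (tmulXi w h)) = innerSL ℂ (B (tmulXi w h)) := by
    refine ext_tmulXi fun v g => ?_
    rw [innerSL_apply_apply, innerSL_apply_apply, ← inner_conj_symm, hAB, inner_conj_symm]
  have h2 := DFunLike.congr_fun this y
  rw [innerSL_apply_apply, innerSL_apply_apply] at h2
  rw [← inner_conj_symm, h2, inner_conj_symm]

/-- The right creation operator `I ⊗ R_j`, with `h ⊗ ξ_w ↦ h ⊗ ξ_{wj}`. -/
def rightCreation (j : Fin d) : HilbertTensor H (Fock d) →L[ℂ] HilbertTensor H (Fock d) :=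
  opTensor (ContinuousLinearMap.id ℂ H)
    ((orthonormal_xi d).comp (fun w : Word d => w * FreeMonoid.of j)
      fun _ _ h => (mul_of_inj.1 h).2).orthogonalFamily.linearIsometry.toContinuousLinearMap

theorem rightCreation_tmulXi (j : Fin d) (w : Word d) (h : H) :
    rightCreation j (tmulXi w h) = tmulXi (w * FreeMonoid.of j) h := by
  have hw := ((orthonormal_xi d).comp (fun w : Word d => w * FreeMonoid.of j)
    fun _ _ h => (mul_of_inj.1 h).2).orthogonalFamily.linearIsometry_apply_single
      (i := w) (1 : ℂ)
  simp only [LinearIsometry.toSpanSingleton_apply, one_smul, Function.comp_apply] at hw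
  rw [rightCreation, opTensor_tmulXi, tmulXi_apply]
  exact congrArg (fun f : Fock d => ((h ⊗ₜ[ℂ] f : H ⊗[ℂ] Fock d) : HilbertTensor H (Fock d))) hw

variable [CompleteSpace H]

/-- The matrix coefficients of a multi-Toeplitz polynomial. -/
theorem inner_toeplitzPoly (n : ℕ) (Q : Word d → H →L[ℂ] H) (v w : Word d) (g h : H) :
    ⟪tmulXi v g, toeplitzPoly n Q (tmulXi w h)⟫ =
      (if v = w then ⟪g, Q 1 h⟫ else 0) +
      ∑ u ∈ wordsLE d n with 0 < u.length, (if v = u * w then ⟪g, Q u h⟫ else 0) +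
      ∑ u ∈ wordsLE d n with 0 < u.length, (if u * v = w then ⟪Q u g, h⟫ else 0) := by
  have h1 : ∀ (u : Word d), ⟪tmulXi v g, opTensor (adjoint (Q u))
      (adjoint (leftCreationWord u)) (tmulXi w h)⟫ = if u * v = w then ⟪Q u g, h⟫ else 0 := by
    intro u
    rw [opTensor_tmulXi, tmulXi_apply, UniformSpace.Completion.inner_coe,
      TensorProduct.inner_tmul, adjoint_inner_right, adjoint_inner_right, leftCreationWord_xi,
      inner_xi]
    simp
  have h2 : opTensor (Q 1) (ContinuousLinearMap.id ℂ (Fock d)) (tmulXi w h) =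
      tmulXi w (Q 1 h) := by
    rw [opTensor_tmulXi, tmulXi_apply, ContinuousLinearMap.id_apply]
  simp only [toeplitzPoly, add_apply, sum_apply,
    inner_add_right, inner_sum, h1, h2, opTensor_leftCreationWord_tmulXi, inner_tmulXi]

/-- The coefficients `Q_u` multiply words on the left only, so equal last letters cancel and
different ones never match. -/
theorem inner_toeplitzPoly_mul_of (n : ℕ) (Q : Word d → H →L[ℂ] H) (v w : Word d) (g h : H)
    (i j : Fin d) :
    ⟪tmulXi (v * FreeMonoid.of i) g, toeplitzPoly n Q (tmulXi (w * FreeMonoid.of j) h)⟫ =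
      if i = j then ⟪tmulXi v g, toeplitzPoly n Q (tmulXi w h)⟫ else 0 := by
  simp only [inner_toeplitzPoly, ← mul_assoc, mul_of_inj]
  by_cases hij : i = j <;> simp [hij]

theorem inner_toeplitzPoly_tmulXi_one_eq_zero {n : ℕ} (Q : Word d → H →L[ℂ] H) {v : Word d}
    (hv : n < v.length) (g h : H) :
    ⟪tmulXi v g, toeplitzPoly n Q (tmulXi 1 h)⟫ = 0 := by
  have h1 : v ≠ 1 := by rintro rfl; simp at hv
  have h2 : ∀ u ∈ wordsLE d n, v ≠ u * 1 := by
    rintro u hu rfl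
    rw [mul_one] at hv
    exact absurd (mem_wordsLE.1 hu) (not_le.2 hv)
  have h3 : ∀ u : Word d, u * v ≠ 1 := by
    intro u hu
    have := congrArg FreeMonoid.length hu
    simp only [FreeMonoid.length_mul, FreeMonoid.length_one] at this
    omega
  rw [inner_toeplitzPoly, if_neg h1, Finset.sum_eq_zero, Finset.sum_eq_zero, add_zero, add_zero]
  · intro u _
    rw [if_neg (h3 u)]
  · intro u hu
    rw [if_neg (h2 u (Finset.mem_filter.1 hu).1)]

theorem inner_toeplitzPoly_rightCreation (n : ℕ) (Q : Word d → H →L[ℂ] H) (i j : Fin d)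
    (x y : HilbertTensor H (Fock d)) :
    ⟪rightCreation i x, toeplitzPoly n Q (rightCreation j y)⟫ =
      if i = j then ⟪x, toeplitzPoly n Q y⟫ else 0 := by
  have h : adjoint (rightCreation i) ∘L toeplitzPoly n Q ∘L rightCreation j =
      if i = j then toeplitzPoly n Q else 0 := by
    refine ext_inner_tmulXi fun v w g h => ?_
    rw [ContinuousLinearMap.comp_apply, adjoint_inner_right, ContinuousLinearMap.comp_apply,
      rightCreation_tmulXi, rightCreation_tmulXi, inner_toeplitzPoly_mul_of]
    split_ifs <;> simp
  have h2 := congrArg (fun A => ⟪x, A y⟫) h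
  simp only [ContinuousLinearMap.comp_apply, adjoint_inner_right] at h2
  rw [h2]
  split_ifs <;> simp

variable {G : Type*} [NormedAddCommGroup G] [InnerProductSpace ℂ G] [CompleteSpace G]

/-- A factorization `⟪x, T y⟫ = ⟪e x, e y⟫` in which `e` intertwines right creation operators
with a row isometry, and has degree at most `n`, can be replaced by one through an analytic
polynomial of degree at most `n`. -/
theorem exists_analyticPoly_of_isRowIsometry {e : HilbertTensor H (Fock d) →L[ℂ] G}
    (he : DenseRange e) {V : Fin d → G →L[ℂ] G} (hV : IsRowIsometry V)
    (hVe : ∀ j x, V j (e x) = e (rightCreation j x)) (n : ℕ)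
    (hdeg : ∀ (v : Word d) (g h : H), n < v.length →
      ⟪e (tmulXi v g), e (tmulXi 1 h)⟫ = 0) :
    ∃ F : Word d → H →L[ℂ] H, ∀ v w g h, ⟪e (tmulXi v g), e (tmulXi w h)⟫ =
      ⟪analyticPoly n F (tmulXi v g), analyticPoly n F (tmulXi w h)⟫ := by
  have hVw : ∀ v w h, revWordOp V v (e (tmulXi w h)) = e (tmulXi (w * v) h) := by
    intro v w h
    induction v using word_reverse_induction with
    | one => rw [revWordOp_one, one_apply_eq_self, mul_one]
    | mul_of v j ih =>
      rw [revWordOp_mul_of, mul_apply_eq_comp, ih, hVe, rightCreation_tmulXi, mul_assoc]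
  have hann : ∀ h (w : Word d), w.length = n + 1 →
      adjoint (revWordOp V w) (e (tmulXi 1 h)) = 0 := by
    intro h w hw
    -- Pairing with `e (g ⊗ ξ_v)` moves `V_w` across and gives `e (g ⊗ ξ_{vw})`, where `|vw| > n`.
    have h0 : innerSL ℂ (adjoint (revWordOp V w) (e (tmulXi 1 h))) ∘L e = 0 := by
      refine ext_tmulXi fun v g => ?_
      rw [ContinuousLinearMap.comp_apply, innerSL_apply_apply, adjoint_inner_left, hVw,
        ← inner_conj_symm, hdeg (v * w), map_zero, zero_apply]
      rw [FreeMonoid.length_mul]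
      omega
    refine ext_inner_right ℂ fun y => ?_
    refine he.induction_on (p := fun y => ⟪_, y⟫ = ⟪(0 : G), y⟫) y
      (isClosed_eq (by fun_prop) (by fun_prop)) fun a => ?_
    rw [inner_zero_left]
    exact DFunLike.congr_fun h0 a
  let C : H →L[ℂ] G := wandering V ∘L e ∘L tmulXi 1
  have hC : ∀ x, wandering V x ∈ closedRange C := by
    -- Membership in `closedRange C` is phrased as an operator identity so that it can be checked on
    -- the vectors `h ⊗ ξ_w`.
    have h0 : (closedRange C).starProjection ∘L wandering V ∘L e = wandering V ∘L e := by
      refine ext_tmulXi fun w h => ?_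
      rw [ContinuousLinearMap.comp_apply, Submodule.starProjection_eq_self_iff]
      induction w using word_reverse_induction with
      | one => exact (toClosedRange C h).2
      | mul_of w j _ =>
        rw [ContinuousLinearMap.comp_apply, ← rightCreation_tmulXi, ← hVe,
          hV.wandering_apply_isometry]
        exact zero_mem _
    intro x
    refine he.induction_on (p := fun x => wandering V x ∈ closedRange C) x
      ((Submodule.isClosed_topologicalClosure _).preimage (wandering V).continuous) fun a => ?_
    rw [← Submodule.starProjection_eq_self_iff]
    exact DFunLike.congr_fun h0 a
  obtain ⟨J, hJ⟩ := exists_isometric_on_closedRange C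
  let A : Word d → H →L[ℂ] G := fun v =>
    wandering V ∘L adjoint (revWordOp V v) ∘L e ∘L tmulXi 1
  have hA : ∀ w h, e (tmulXi w h) = ∑ v ∈ wordsLE d n, revWordOp V (v * w) (A v h) := by
    intro w h
    have h1 := hVw w 1 h
    rw [one_mul] at h1
    rw [← h1, ← sum_revWordOp_wandering V n _ (hann h), map_sum]
    refine Finset.sum_congr rfl fun v _ => ?_
    rw [revWordOp_mul]
    rfl
  refine ⟨fun v => J ∘L A v, fun v w g h => ?_⟩
  rw [hA, hA]
  simp only [analyticPoly, sum_apply, opTensor_leftCreationWord_tmulXi,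
    sum_inner, inner_sum, inner_tmulXi]
  -- Both Gram sums have the same vanishing condition on words, and `J` preserves the remaining
  -- inner products in `W`.
  refine Finset.sum_congr rfl fun a _ => Finset.sum_congr rfl fun b _ => ?_
  refine (hV.inner_revWordOp_wandering _ _ _ _).trans ?_
  exact if_congr Iff.rfl (hJ (A b g) (hC _) (A a h) (hC _)).symm rfl

end Factorization

end FejerRiesz

end

theorem theorem3p3 {H : Type*} [NormedAddCommGroup H] [InnerProductSpace ℂ H] [CompleteSpace H]
    (d n : ℕ) (Q : FejerRiesz.Word d → H →L[ℂ] H)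
    (hQ : (FejerRiesz.toeplitzPoly n Q).IsPositive) :
    ∃ F : FejerRiesz.Word d → H →L[ℂ] H,
      FejerRiesz.toeplitzPoly n Q =
        ContinuousLinearMap.adjoint (FejerRiesz.analyticPoly n F) ∘L
          FejerRiesz.analyticPoly n F := by
  open FejerRiesz ContinuousLinearMap in
  obtain ⟨S, hS⟩ := exists_inner_eq_of_isPositive hQ
  let e := toClosedRange S
  have he : DenseRange e := denseRange_toClosedRange S
  have hT : ∀ x y, inner ℂ (e x) (e y) = inner ℂ x (toeplitzPoly n Q y) := hS
  have hR : ∀ (i j : Fin d) x y, inner ℂ (e (rightCreation i x)) (e (rightCreation j y)) =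
      if i = j then inner ℂ (e x) (e y) else 0 := fun i j x y => by
    rw [hT, inner_toeplitzPoly_rightCreation, hT]
  -- The case `i = j` of `hR` gives `‖e (R_j x)‖ = ‖e x‖`, so `V_j` is well defined.
  choose V hVe using fun j : Fin d => exists_extension_of_inner_eq e (e ∘L rightCreation j) he
    fun x => by simpa using hR j j x x
  simp only [ContinuousLinearMap.comp_apply] at hVe
  have hV : IsRowIsometry V := by
    intro i j x y
    refine he.induction_on₂
      (p := fun x y => inner ℂ (V i x) (V j y) = if i = j then inner ℂ x y else 0) ?_ ?_ x y
    · refine isClosed_eq (by fun_prop) ?_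
      split_ifs <;> fun_prop
    · intro a b
      rw [hVe, hVe, hR]
  obtain ⟨F, hF⟩ := exists_analyticPoly_of_isRowIsometry he hV hVe n fun v g h hv => by
    rw [hT, inner_toeplitzPoly_tmulXi_one_eq_zero Q hv]
  refine ⟨F, ext_inner_tmulXi fun v w g h => ?_⟩
  rw [← hT, ContinuousLinearMap.comp_apply, adjoint_inner_right, hF]
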